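/- Let $m\ge 1$, let $\Delta^m=\{z\in\mathbb R_{\ge 0}^m:\sum_y z_y=1\}$, let $(X,Y)$ be a pair of random variables on a probability space $(\Omega,\mathcal A,\mu)$ with values in $\mathcal X\times\{1,\dots,m\}$ ($\mathcal X$ a measurable space), let $g:\mathcal X\to\Delta^m$ be measurable, put $G:=g(X)$, and let $\mu_G$ be the law of $G$. Let $\delta(t):=(\mathbb P[Y=y\mid G=t]-t_y)_{y=1}^m$ for $t\in\Delta^m$ (by a regular conditional distribution of $Y$ given $G$). The model $g$ is called strongly calibrated if $\delta(G)=0$ almost surely; this is the null hypothesis $H_0$. Let $k:\Delta^m\times\Delta^m\to\mathbb R^{m\times m}$ be a matrix-valued kernel, i.e. $k(s,t)=k(t,s)^{\top}$ and $\sum_{i,j=1}^n u_i^{\top}k(t_i,t_j)u_j\ge 0$ for all $n$, $t_i\in\Delta^m$, $u_i\in\mathbb R^m$. Let $\mathcal F$ be the closed unit ball of the reproducing kernel Hilbert space of functions $\Delta^m\to\mathbb R^m$ with kernel $k$, and let $$\mathrm{SKCE}:=\Bigl(\sup_{f\in\mathcal F}\mathbb E\bigl[\langle\delta(G),f(G)\rangle\bigr]\Bigr)^2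 .$$ Let $(X_1,Y_1),(X_2,Y_2),\dots$ be i.i.d. copies of $(X,Y)$, let $e_y$ be the $y$-th unit vector of $\mathbb R^m$, and for $n\ge 2$ let $$h_{i,j}:=(e_{Y_i}-g(X_i))^{\top}k(g(X_i),g(X_j))(e_{Y_j}-g(X_j)),\qquad \mathrm{SKCE}_{ul}:=\frac1{\lfloor n/2\rfloor}\sum_{i=1}^{\lfloor n/2\rfloor}h_{2i-1,2i}.$$ Assume that $k(\cdot,t)u$ is measurable for all $t\in\Delta^m$ and $u\in\mathbb R^m$, that $\|k\|_{\mu_G,1}:=\int\|k(t,t)\|^{1/2}\,\mu_G(\mathrm dt)<\infty$, and that $h_{1,2}$ (as a function of $((X_1,Y_1),(X_2,Y_2))$, measurable up to null sets of their joint law) has finite variance $\sigma^2:=\operatorname{Var}[h_{1,2}]<\infty$, $\sigma\ge 0$. Then every $f\in\mathcal F$ is $\mu_G$-integrable, $\mathrm{SKCE}$ is finite, and $$\sqrt{\lfloor n/2\rfloor}\,\bigl(\mathrm{SKCE}_{ul}-\mathrm{SKCE}\bigr)\xrightarrow{d}\mathcal N(0,\sigma^2)\qquad(n\to\infty).$$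 Moreover, under $H_0$ and if $\sigma>0$, for every $t\in\mathbb R$ $$\mathbb P\bigl[\sqrt{\lfloor n/2\rfloor}\,\mathrm{SKCE}_{ul}\ge t\bigr]\to 1-\Phi(t/\sigma),$$ and, with $\hat\sigma_n$ the sample standard deviation (with divisor $\lfloor n/2\rfloor-1$) of $h_{2i-1,2i}$, $i=1,\dots,\lfloor n/2\rfloor$, almost surely $$\mathbb P\bigl[\sqrt{\lfloor n/2\rfloor}\,\mathrm{SKCE}_{ul}\ge t\bigr]-\bigl(1-\Phi(t/\hat\sigma_n)\bigr)\to 0,$$ where $\Phi$ is the standard normal distribution function. -/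

import Mathlib

open MeasureTheory ProbabilityTheory Filter Topology
open scoped InnerProductSpace

noncomputable section

namespace CalibrationError

/-- The probability simplex in `ℝᵐ`, with its Borel `σ`-algebra (as a subspace). -/
abbrev Simplex (m : ℕ) : Type := ↥(stdSimplex ℝ (Fin m))

/-- `ℝᵐ` with the Euclidean inner product. -/
abbrev Vec (m : ℕ) : Type := EuclideanSpace ℝ (Fin m)

/-- A matrix-valued kernel on the simplex: `k s t = (k t s)ᵀ`, and `k` is positive semi-definite.
Matrices in `ℝ^{m × m}` are written as linear operators on `ℝᵐ`. -/
structure IsMatrixKernel {m : ℕ} (k : Simplex m → Simplex m → (Vec m →L[ℝ] Vec m)) : Prop where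
  symm : ∀ s t, k s t = ContinuousLinearMap.adjoint (k t s)
  pos : ∀ (n : ℕ) (t : Fin n → Simplex m) (u : Fin n → Vec m),
    0 ≤ ∑ i, ∑ j, ⟪u i, k (t i) (t j) (u j)⟫_ℝ

/-- The form of positive semi-definiteness from which Mathlib constructs the reproducing kernel
Hilbert space of `k`. -/
theorem IsMatrixKernel.posSemidef {m : ℕ} {k : Simplex m → Simplex m → (Vec m →L[ℝ] Vec m)}
    (hk : IsMatrixKernel k) : (Matrix.of k).PosSemidef := by
  have tfae := (RKHS.posSemidef_tfae (K := Matrix.of k)).out 0 2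
  refine tfae.mpr ⟨?_, fun vv => ?_⟩
  · ext1 s t
    exact (hk.symm s t).symm
  · let e := vv.support.equivFin.symm
    have h := hk.pos _ (fun i => (e i : Simplex m)) (fun i => vv (e i))
    have key : (vv.sum fun x w => vv.sum fun x' w' => ⟪Matrix.of k x' x w, w'⟫_ℝ)
        = ∑ i, ∑ j, ⟪vv (e i), k (e i) (e j) (vv (e j))⟫_ℝ := by
      rw [Finset.sum_comm, Finsupp.sum, ← Finset.sum_coe_sort vv.support,
        ← Equiv.sum_comp e]
      refine Finset.sum_congr rfl fun j _ => ?_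
      rw [Finsupp.sum, ← Finset.sum_coe_sort vv.support, ← Equiv.sum_comp e]
      exact Finset.sum_congr rfl fun i _ => real_inner_comm _ _
    rw [key]
    simpa using h

/-- The closed unit ball of the reproducing kernel Hilbert space with kernel `k`, as a set of
functions from the simplex to `ℝᵐ`. -/
def rkhsUnitBall {m : ℕ} (k : Simplex m → Simplex m → (Vec m →L[ℝ] Vec m))
    (hk : IsMatrixKernel k) : Set (Simplex m → Vec m) :=
  haveI : Fact (Matrix.of k).PosSemidef := ⟨hk.posSemidef⟩
  {f | ∃ φ : RKHS.OfKernel (Matrix.of k), ‖φ‖ ≤ 1 ∧ (fun t => φ t) = f}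

/-- The norm `‖k‖_{ν,p}`: the `L^p(ν)`-norm of `t ↦ ‖k(t,t)‖^{1/2}`. -/
def kernelNorm {m : ℕ} (k : Simplex m → Simplex m → (Vec m →L[ℝ] Vec m))
    (p : ENNReal) (ν : Measure (Simplex m)) : ENNReal :=
  eLpNorm (fun t => √‖k t t‖) p ν

section Model

variable {Ω : Type*} [MeasurableSpace Ω] {m : ℕ} [NeZero m]

/-- `δ(t) = (ℙ[Y = y | G = t] - t_y)_y`, by the regular conditional distribution of `Y`
given `G`. -/
def deviation (μ : Measure Ω) [IsFiniteMeasure μ] (Y : Ω → Fin m) (G : Ω → Simplex m)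
    (t : Simplex m) : Vec m :=
  WithLp.toLp 2 fun y => (condDistrib Y G μ t).real {y} - (t : Fin m → ℝ) y

/-- The predictions `G` of `Y` are calibrated in the strong sense: `δ(G) = 0` almost surely. -/
def StronglyCalibrated (μ : Measure Ω) [IsFiniteMeasure μ] (Y : Ω → Fin m)
    (G : Ω → Simplex m) : Prop :=
  ∀ᵐ ω ∂μ, deviation μ Y G (G ω) = 0

/-- The calibration error with respect to a class `F` of functions:
`sup_{f ∈ F} E[⟨δ(G), f(G)⟩]`, which may be infinite. -/
def ce (F : Set (Simplex m → Vec m)) (μ : Measure Ω) [IsFiniteMeasure μ] (Y : Ω → Fin m)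
    (G : Ω → Simplex m) : EReal :=
  ⨆ f ∈ F, ((∫ ω, ⟪deviation μ Y G (G ω), f (G ω)⟫_ℝ ∂μ : ℝ) : EReal)

/-- The kernel calibration error. -/
def kce (k : Simplex m → Simplex m → (Vec m →L[ℝ] Vec m)) (hk : IsMatrixKernel k)
    (μ : Measure Ω) [IsFiniteMeasure μ] (Y : Ω → Fin m) (G : Ω → Simplex m) : EReal :=
  ce (rkhsUnitBall k hk) μ Y G

/-- The squared kernel calibration error. -/
def skce (k : Simplex m → Simplex m → (Vec m →L[ℝ] Vec m)) (hk : IsMatrixKernel k)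
    (μ : Measure Ω) [IsFiniteMeasure μ] (Y : Ω → Fin m) (G : Ω → Simplex m) : EReal :=
  kce k hk μ Y G ^ 2

end Model

section Estimator

variable {S : Type*} {m : ℕ}

/-- `δ(x, y) = e_y - g(x)`. -/
def residual (g : S → Simplex m) (z : S × Fin m) : Vec m :=
  EuclideanSpace.single z.2 (1 : ℝ) - WithLp.toLp 2 (g z.1 : Fin m → ℝ)

/-- `h((x,y),(x',y')) = ⟨δ(x,y), k(g(x),g(x')) δ(x',y')⟩`. -/
def hker (k : Simplex m → Simplex m → (Vec m →L[ℝ] Vec m)) (g : S → Simplex m)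
    (z z' : S × Fin m) : ℝ :=
  ⟪residual g z, k (g z.1) (g z'.1) (residual g z')⟫_ℝ

/-- The linear estimator `⌊n/2⌋⁻¹ ∑_{i=1}^{⌊n/2⌋} h_{2i-1,2i}`. The data points are numbered from
`0` here, so that the `i`-th pair is `(d (2i), d (2i+1))` for `i < ⌊n/2⌋`. -/
def skceUL (k : Simplex m → Simplex m → (Vec m →L[ℝ] Vec m)) (g : S → Simplex m)
    (n : ℕ) (d : ℕ → S × Fin m) : ℝ :=
  ((n / 2 : ℕ) : ℝ)⁻¹ * ∑ i ∈ Finset.range (n / 2), hker k g (d (2 * i)) (d (2 * i + 1))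

/-- The sample standard deviation of the `⌊n/2⌋` terms of the linear estimator. -/
def sampleSD (k : Simplex m → Simplex m → (Vec m →L[ℝ] Vec m)) (g : S → Simplex m)
    (n : ℕ) (d : ℕ → S × Fin m) : ℝ :=
  √((((n / 2 : ℕ) : ℝ) - 1)⁻¹ *
    ∑ i ∈ Finset.range (n / 2), (hker k g (d (2 * i)) (d (2 * i + 1)) - skceUL k g n d) ^ 2)

end Estimator

end CalibrationError

end

/-!
Let `H` be the reproducing kernel Hilbert space of `k`. Its elements are measurable, as pointwise
limits of combinations of the functions `k(·, t) u`, and `‖f(t)‖ ≤ ‖f‖ ‖k(t,t)‖^{1/2}`, so that the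
moment condition makes them integrable (`integrable_rkhs`) and makes the functional
`f ↦ E⟨e_Y - g(X), f(g(X))⟩` bounded on `H`. The Riesz representation theorem gives `τ ∈ H` with
`⟪τ, f⟫ = E⟨e_Y - g(X), f(g(X))⟩` (`exists_inner_eq_integral`), and conditioning on `G = g(X)` turns
the right-hand side into `E⟨δ(G), f(G)⟩` (`integral_residual_eq_integral_deviation`). The supremum
over the unit ball is therefore `‖τ‖`, and `SKCE = ‖τ‖²`, which vanishes under strong calibration.

By Fubini's theorem and the reproducing property, `E[h_{1,2}] = E⟨e_Y - g(X), τ(g(X))⟩ = ‖τ‖²`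
(`exists_skce_eq_integral_hker`): the terms of the linear estimator are unbiased. They are functions
of non-overlapping pairs of the data, hence i.i.d. (`iIndepFun_and_identDistrib_of_pairs`), with
variance `σ²`. The central limit theorem is the asymptotic normality. The limit law has no atoms if
`σ > 0`, whence the convergence of the tail probabilities; the strong law of large numbers, applied
to the terms and to their squares, gives `σ̂ₙ → σ` almost surely (`ae_tendsto_sampleVariance`), and the
continuity of `Φ` allows `σ` to be replaced by `σ̂ₙ`.

The kernel is only assumed separately measurable, so `t ↦ ‖k(t,t)‖` need not be measurable and `h` is
measurable only up to null sets of the product law. The moment condition is used as a bound on an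
upper integral, and independence of the terms is derived for a measurable modification of `h`.
-/

namespace CalibrationError

/-! ### Measurability and integrability in a reproducing kernel Hilbert space -/

section RKHS

variable {T V H : Type*} [MeasurableSpace T]
  [NormedAddCommGroup V] [InnerProductSpace ℝ V] [CompleteSpace V]
  [NormedAddCommGroup H] [InnerProductSpace ℝ H] [CompleteSpace H] [RKHS ℝ H T V]

/-- The diagonal of the kernel need not be measurable; the right-hand side is an upper integral. -/
theorem eLpNorm_rkhs_le (ν : Measure T) (p : ENNReal) (f : H) :
    eLpNorm (f : T → V) p ν ≤
      ENNReal.ofReal ‖f‖ * eLpNorm (fun t => √‖RKHS.kernel H t t‖) p ν := by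
  refine eLpNorm_le_mul_eLpNorm_of_ae_le_mul (Eventually.of_forall fun t => ?_) p
  rw [Real.norm_of_nonneg (Real.sqrt_nonneg _)]
  exact RKHS.norm_apply_le f t

variable [MeasurableSpace V] [BorelSpace V] [SecondCountableTopology V]

/-- The span of the kernel functions is dense, and norm convergence implies pointwise convergence,
so that every element is a pointwise limit of a sequence of measurable functions. -/
theorem measurable_rkhs (hm : ∀ t u, Measurable fun s => RKHS.kernel H s t u) (f : H) :
    Measurable (f : T → V) := by
  have hf : f ∈ closure (Submodule.span ℝ {x | ∃ t v, RKHS.kerFun H t v = x} : Set H) := by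
    rw [← Submodule.topologicalClosure_coe, RKHS.kerFun_dense H]
    trivial
  obtain ⟨u, hu, hlim⟩ := mem_closure_iff_seq_limit.1 hf
  refine measurable_of_tendsto_metrizable (f := fun n => (u n : T → V)) (fun n => ?_)
    (tendsto_pi_nhds.2 fun t => ((RKHS.continuous_eval t).tendsto f).comp hlim)
  refine Submodule.span_induction ?_ ?_ ?_ ?_ (hu n)
  · rintro _ ⟨t, v, rfl⟩
    rw [funext fun s => RKHS.kerFun_apply H t v s]
    exact hm t v
  · rw [RKHS.coe_zero]
    exact measurable_const
  · intro a b _ _ ha hb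
    simpa using! ha.add hb
  · intro c a _ ha
    simpa using! ha.const_smul c

theorem integrable_rkhs (hm : ∀ t u, Measurable fun s => RKHS.kernel H s t u) {ν : Measure T}
    (hν : eLpNorm (fun t => √‖RKHS.kernel H t t‖) 1 ν < ⊤) (f : H) :
    Integrable (f : T → V) ν := by
  refine memLp_one_iff_integrable.1 ⟨(measurable_rkhs hm f).aestronglyMeasurable, ?_⟩
  exact (eLpNorm_rkhs_le ν 1 f).trans_lt (ENNReal.mul_lt_top ENNReal.ofReal_lt_top hν)

/-- The functional `f ↦ E⟨r, f(G)⟩` is bounded for bounded `r`, and the Riesz representation theorem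
gives an element of the Hilbert space that represents it. -/
theorem exists_inner_eq_integral {Z : Type*} [MeasurableSpace Z] {L : Measure Z}
    {G : Z → T} (hG : Measurable G) {r : Z → V} (hr : Measurable r) {C : ℝ} (hC : ∀ z, ‖r z‖ ≤ C)
    (hm : ∀ t u, Measurable fun s => RKHS.kernel H s t u)
    (hν : eLpNorm (fun t => √‖RKHS.kernel H t t‖) 1 (L.map G) < ⊤) :
    ∃ τ : H, ∀ f : H, Integrable (fun z => ⟪r z, f (G z)⟫_ℝ) L ∧
      ⟪τ, f⟫_ℝ = ∫ z, ⟪r z, f (G z)⟫_ℝ ∂L := by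
  have hfG (f : H) : Integrable (fun z => f (G z)) L :=
    (integrable_rkhs hm hν f).comp_measurable hG
  have hle (f : H) (z : Z) : ‖⟪r z, f (G z)⟫_ℝ‖ ≤ C * ‖f (G z)‖ :=
    (norm_inner_le_norm _ _).trans (mul_le_mul_of_nonneg_right (hC z) (norm_nonneg _))
  have hint (f : H) : Integrable (fun z => ⟪r z, f (G z)⟫_ℝ) L :=
    ((hfG f).norm.const_mul C).mono' (hr.inner ((measurable_rkhs hm f).comp hG)).aestronglyMeasurable
      (Eventually.of_forall (hle f))
  let K := (eLpNorm (fun t => √‖RKHS.kernel H t t‖) 1 (L.map G)).toReal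
  have hnorm (f : H) : ∫ z, ‖f (G z)‖ ∂L ≤ ‖f‖ * K := by
    rw [integral_norm_eq_lintegral_enorm (hfG f).aestronglyMeasurable,
      ← eLpNorm_one_eq_lintegral_enorm]
    have h := eLpNorm_rkhs_le (L.map G) 1 f
    rw [eLpNorm_map_measure (measurable_rkhs hm f).aestronglyMeasurable hG.aemeasurable] at h
    refine (ENNReal.toReal_mono (ENNReal.mul_lt_top ENNReal.ofReal_lt_top hν).ne h).trans_eq ?_
    rw [ENNReal.toReal_mul, ENNReal.toReal_ofReal (norm_nonneg _)]
  let ℓ : H →ₗ[ℝ] ℝ :=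
    { toFun := fun f => ∫ z, ⟪r z, f (G z)⟫_ℝ ∂L
      map_add' := fun f h => by
        simp only [RKHS.coe_add, Pi.add_apply, inner_add_right]
        exact integral_add (hint f) (hint h)
      map_smul' := fun c f => by
        simp only [RKHS.coe_smul, Pi.smul_apply, inner_smul_right, RingHom.id_apply, smul_eq_mul]
        exact integral_const_mul _ _ }
  -- the absolute value of `C` covers an empty `Z`, where `C` may be negative
  let ℓ' : H →L[ℝ] ℝ := ℓ.mkContinuous (|C| * K) fun f => by
    calc ‖∫ z, ⟪r z, f (G z)⟫_ℝ ∂L‖ ≤ ∫ z, |C| * ‖f (G z)‖ ∂L :=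
          norm_integral_le_of_norm_le ((hfG f).norm.const_mul _) (Eventually.of_forall fun z =>
            (hle f z).trans (mul_le_mul_of_nonneg_right (le_abs_self C) (norm_nonneg _)))
      _ = |C| * ∫ z, ‖f (G z)‖ ∂L := integral_const_mul _ _
      _ ≤ |C| * (‖f‖ * K) := mul_le_mul_of_nonneg_left (hnorm f) (abs_nonneg C)
      _ = |C| * K * ‖f‖ := by ring
  exact ⟨(InnerProductSpace.toDual ℝ H).symm ℓ', fun f => ⟨hint f, by
    rw [InnerProductSpace.toDual_symm_apply]; rfl⟩⟩

end RKHS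

/-- The norm of a vector of a real inner product space is the supremum of its inner products with the
vectors of the closed unit ball. -/
theorem iSup_inner_unitBall_eq_norm {H : Type*} [NormedAddCommGroup H] [InnerProductSpace ℝ H]
    (τ : H) : ⨆ (φ : H) (_ : ‖φ‖ ≤ 1), ((⟪τ, φ⟫_ℝ : ℝ) : EReal) = (‖τ‖ : ℝ) := by
  refine le_antisymm (iSup₂_le fun φ hφ => ?_) ?_
  · exact EReal.coe_le_coe_iff.2 ((real_inner_le_norm τ φ).trans
      (mul_le_of_le_one_right (norm_nonneg _) hφ))
  · have h1 : ‖‖τ‖⁻¹ • τ‖ ≤ 1 := by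
      rw [norm_smul, norm_inv, norm_norm]
      exact inv_mul_le_one
    refine le_iSup₂_of_le (‖τ‖⁻¹ • τ) h1 (EReal.coe_le_coe_iff.2 ?_)
    rw [inner_smul_right, real_inner_self_eq_norm_sq]
    rcases eq_or_ne ‖τ‖ 0 with h | h
    · simp [h]
    · rw [sq, inv_mul_cancel_left₀ h]

/-! ### The kernel calibration error as a norm -/

section Residual

variable {S : Type*} {m : ℕ}

theorem measurable_toLp_simplex :
    Measurable fun t : Simplex m => (WithLp.toLp 2 (t : Fin m → ℝ) : Vec m) :=
  (WithLp.measurable_toLp 2 _).comp measurable_subtype_coe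

theorem measurable_residual [MeasurableSpace S] {g : S → Simplex m} (hg : Measurable g) :
    Measurable (residual g) := by
  unfold residual
  exact ((measurable_of_countable fun y : Fin m => EuclideanSpace.single y (1 : ℝ)).comp
    measurable_snd).sub (measurable_toLp_simplex.comp (hg.comp measurable_fst))

theorem norm_residual_le (g : S → Simplex m) (z : S × Fin m) : ‖residual g z‖ ≤ 2 := by
  have hs : ‖(WithLp.toLp 2 (g z.1 : Fin m → ℝ) : Vec m)‖ ≤ 1 := by
    rw [EuclideanSpace.norm_eq, Real.sqrt_le_one]
    calc ∑ i, ‖(g z.1).1 i‖ ^ 2 ≤ ∑ i, (g z.1).1 i := by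
          refine Finset.sum_le_sum fun i _ => ?_
          rw [Real.norm_of_nonneg ((g z.1).2.1 i)]
          exact pow_le_of_le_one ((g z.1).2.1 i) (mem_Icc_of_mem_stdSimplex (g z.1).2 i).2 two_ne_zero
      _ = 1 := (g z.1).2.2
  refine (norm_sub_le _ _).trans ?_
  rw [PiLp.norm_single, norm_one]
  linarith

end Residual

section Disintegration

variable {Ω : Type*} [MeasurableSpace Ω] {m : ℕ} [NeZero m]

theorem measurable_deviation (μ : Measure Ω) [IsFiniteMeasure μ] (Y : Ω → Fin m)
    (G : Ω → Simplex m) : Measurable (deviation μ Y G) := by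
  refine (WithLp.measurable_toLp 2 _).comp (measurable_pi_lambda _ fun y => ?_)
  exact (Kernel.measurable_coe _ (measurableSet_singleton y)).ennreal_toReal.sub
    ((measurable_pi_apply y).comp measurable_subtype_coe)

/-- Averaging the residual `residual id (t, y) = e_y - t` over the conditional distribution of the
label given `G = t` gives the deviation. -/
theorem integral_residual_eq_integral_deviation {μ : Measure Ω} [IsFiniteMeasure μ]
    {Y : Ω → Fin m} (hY : Measurable Y) {G : Ω → Simplex m} (hG : Measurable G)
    {f : Simplex m → Vec m} (hf : Measurable f)
    (hint : Integrable (fun ω => ⟪residual id (G ω, Y ω), f (G ω)⟫_ℝ) μ) :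
    ∫ ω, ⟪residual id (G ω, Y ω), f (G ω)⟫_ℝ ∂μ = ∫ ω, ⟪deviation μ Y G (G ω), f (G ω)⟫_ℝ ∂μ := by
  have hmeas : Measurable fun p : Simplex m × Fin m => ⟪residual id p, f p.1⟫_ℝ :=
    (measurable_residual measurable_id).inner (hf.comp measurable_fst)
  have hGY : Measurable fun ω => (G ω, Y ω) := hG.prodMk hY
  rw [← integral_map (φ := fun ω => (G ω, Y ω)) (f := fun p => ⟪residual id p, f p.1⟫_ℝ)
      hGY.aemeasurable hmeas.aestronglyMeasurable,
    ← integral_map (φ := G) (f := fun t => ⟪deviation μ Y G t, f t⟫_ℝ) hG.aemeasurable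
      ((measurable_deviation μ Y G).inner hf).aestronglyMeasurable,
    ← compProd_map_condDistrib hY.aemeasurable, Measure.integral_compProd]
  · refine integral_congr_ae (Eventually.of_forall fun t => ?_)
    beta_reduce
    rw [integral_fintype .of_finite]
    simp_rw [smul_eq_mul, ← real_inner_smul_left]
    rw [← sum_inner]
    congr 1
    have h1 : ∑ y, (condDistrib Y G μ t).real {y} = 1 := by
      simp
    simp only [residual, smul_sub, Finset.sum_sub_distrib, ← Finset.sum_smul, h1, one_smul, id]
    ext y
    simp [deviation, Pi.single_apply]
  · rw [compProd_map_condDistrib hY.aemeasurable]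
    exact (integrable_map_measure hmeas.aestronglyMeasurable hGY.aemeasurable).2 hint

end Disintegration

section MeanElement

theorem forall_mem_rkhsUnitBall_integrable
    {m : ℕ} {k : Simplex m → Simplex m → (Vec m →L[ℝ] Vec m)} (hk : IsMatrixKernel k)
    (hkm : ∀ (t : Simplex m) (u : Vec m), Measurable fun s => k s t u)
    {ν : Measure (Simplex m)} (hν : kernelNorm k 1 ν < ⊤) :
    ∀ f ∈ rkhsUnitBall k hk, Integrable f ν := by
  have : Fact (Matrix.of k).PosSemidef := ⟨hk.posSemidef⟩
  rintro _ ⟨φ, -, rfl⟩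
  refine integrable_rkhs (H := RKHS.OfKernel (Matrix.of k)) ?_ ?_ φ
  · simpa using! hkm
  · simpa using! hν

variable {Ω S : Type*} [MeasurableSpace Ω] [MeasurableSpace S] {m : ℕ} [NeZero m]

/-- With `τ` the element of the Hilbert space that represents `f ↦ E⟨e_Y - g(X), f(g(X))⟩`, the
squared kernel calibration error and the mean of `h` are both equal to `‖τ‖²`, and `τ = 0` under
strong calibration. -/
theorem exists_skce_eq_integral_hker {μ : Measure Ω} [IsProbabilityMeasure μ]
    {X : Ω → S} (hX : Measurable X) {Y : Ω → Fin m} (hY : Measurable Y)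
    {g : S → Simplex m} (hg : Measurable g)
    {k : Simplex m → Simplex m → (Vec m →L[ℝ] Vec m)} (hk : IsMatrixKernel k)
    (hkm : ∀ (t : Simplex m) (u : Vec m), Measurable fun s => k s t u)
    (hk1 : kernelNorm k 1 (μ.map fun ω => g (X ω)) < ⊤)
    {L : Measure (S × Fin m)} (hL : L = μ.map fun ω => (X ω, Y ω))
    (hint : Integrable (fun z : (S × Fin m) × (S × Fin m) => hker k g z.1 z.2) (L.prod L)) :
    ∃ s : ℝ, skce k hk μ Y (fun ω => g (X ω)) = (s : EReal) ∧
      ∫ z : (S × Fin m) × (S × Fin m), hker k g z.1 z.2 ∂(L.prod L) = s ∧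
      (StronglyCalibrated μ Y (fun ω => g (X ω)) → s = 0) := by
  have : Fact (Matrix.of k).PosSemidef := ⟨hk.posSemidef⟩
  set H := RKHS.OfKernel (Matrix.of k)
  have hXY : Measurable fun ω => (X ω, Y ω) := hX.prodMk hY
  have hprob : IsProbabilityMeasure L := hL ▸ Measure.isProbabilityMeasure_map hXY.aemeasurable
  have hG : Measurable fun z : S × Fin m => g z.1 := hg.comp measurable_fst
  have hGX : Measurable fun ω => g (X ω) := hg.comp hX
  have hmap : L.map (fun z => g z.1) = μ.map fun ω => g (X ω) := by
    rw [hL, Measure.map_map hG hXY]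
    rfl
  have hm : ∀ t u, Measurable fun s => RKHS.kernel H s t u := by
    simpa [H] using! hkm
  have hν : eLpNorm (fun t => √‖RKHS.kernel H t t‖) 1 (L.map fun z => g z.1) < ⊤ := by
    rw [hmap]
    simpa [H] using! hk1
  obtain ⟨τ, hτ⟩ := exists_inner_eq_integral (H := H) hG (measurable_residual hg)
    (norm_residual_le g) hm hν
  have hdev (f : H) : ⟪τ, f⟫_ℝ =
      ∫ ω, ⟪deviation μ Y (fun ω => g (X ω)) (g (X ω)), f (g (X ω))⟫_ℝ ∂μ := by
    have hmeas : Measurable fun z : S × Fin m => ⟪residual g z, f (g z.1)⟫_ℝ :=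
      (measurable_residual hg).inner ((measurable_rkhs hm f).comp hG)
    have hi := (hτ f).1
    rw [hL, integrable_map_measure hmeas.aestronglyMeasurable hXY.aemeasurable] at hi
    rw [(hτ f).2, hL, integral_map hXY.aemeasurable hmeas.aestronglyMeasurable]
    exact integral_residual_eq_integral_deviation hY hGX (measurable_rkhs hm f) hi
  refine ⟨‖τ‖ ^ 2, ?_, ?_, fun hcal => ?_⟩
  · have hce : kce k hk μ Y (fun ω => g (X ω)) = (‖τ‖ : ℝ) := by
      rw [← iSup_inner_unitBall_eq_norm τ, kce, ce]
      simp_rw [hdev]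
      refine le_antisymm (iSup₂_le ?_) (iSup₂_le fun φ hφ => ?_)
      · rintro _ ⟨φ, hφ, rfl⟩
        exact le_iSup₂_of_le φ hφ le_rfl
      · exact le_iSup₂_of_le (fun t => φ t) ⟨φ, hφ, rfl⟩ le_rfl
    rw [skce, hce, EReal.coe_pow]
  · -- for fixed `z'`, the map `z ↦ h(z, z')` is the residual paired with the kernel function
    -- `k(·, g(x')) δ(x', y')`
    have hker_eq (z z' : S × Fin m) :
        hker k g z z' = ⟪residual g z, (RKHS.kerFun H (g z'.1) (residual g z')) (g z.1)⟫_ℝ := by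
      rw [hker, RKHS.kerFun_apply, RKHS.OfKernel.kernel_ofKernel]
      rfl
    rw [integral_prod_symm _ hint]
    calc ∫ z', ∫ z, hker k g z z' ∂L ∂L
        = ∫ z', ⟪residual g z', τ (g z'.1)⟫_ℝ ∂L := by
          refine integral_congr_ae (Eventually.of_forall fun z' => ?_)
          simp only [hker_eq]
          rw [← (hτ _).2, RKHS.inner_kerFun, real_inner_comm]
      _ = ‖τ‖ ^ 2 := by rw [← (hτ τ).2, real_inner_self_eq_norm_sq]
  · rw [← real_inner_self_eq_norm_sq, hdev τ]
    refine integral_eq_zero_of_ae ?_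
    filter_upwards [hcal] with ω hω
    simp [hω]

end MeanElement

/-! ### Independent pairs -/

/-- Disjoint pairs from an independent family are independent. -/
theorem iIndepFun_prodMk_of_pairs {Ω ι β : Type*} [MeasurableSpace Ω] [MeasurableSpace β]
    {P : Measure Ω} {X : ι × Bool → Ω → β} (hX : ∀ p, Measurable (X p)) (h : iIndepFun X P) :
    iIndepFun (fun i ω => (X (i, false) ω, X (i, true) ω)) P := by
  classical
  let pair (i : ι) (ω : Ω) : β × β := (X (i, false) ω, X (i, true) ω)
  have hpair (i : ι) : Measurable (pair i) := (hX _).prodMk (hX _)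
  let R : Set (Set (β × β)) := Set.image2 (· ×ˢ ·) {s | MeasurableSet s} {t | MeasurableSet t}
  -- the preimages of measurable rectangles form a π-system that generates the σ-algebra of a pair
  rw [iIndepFun_iff_iIndep]
  refine iIndepSets.iIndep (fun i => (hpair i).comap_le) (fun i => Set.preimage (pair i) '' R)
    (fun i => ?_) (fun i => ?_) ?_
  · convert! isPiSystem_prod.comap (pair i)
  · rw [← generateFrom_prod, MeasurableSpace.comap_generateFrom]
  rw [iIndepSets_iff]
  intro s f hf
  have hf' : ∀ i, ∃ A B : Set β, MeasurableSet A ∧ MeasurableSet B ∧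
      (i ∈ s → f i = X (i, false) ⁻¹' A ∩ X (i, true) ⁻¹' B) := by
    intro i
    by_cases hi : i ∈ s
    · obtain ⟨_, ⟨A, hA, B, hB, rfl⟩, hfi⟩ := hf i hi
      exact ⟨A, B, hA, hB, fun _ => hfi.symm⟩
    · exact ⟨∅, ∅, .empty, .empty, fun h => absurd h hi⟩
  choose A B hA hB hAB using hf'
  let E (p : ι × Bool) : Set β := if p.2 then B p.1 else A p.1
  have hE (p : ι × Bool) : MeasurableSet (E p) := by
    unfold E; split_ifs
    exacts [hB _, hA _]
  have key (u : Finset ι) (hu : u ⊆ s) : P (⋂ i ∈ u, f i) =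
      ∏ i ∈ u, (P (X (i, true) ⁻¹' B i) * P (X (i, false) ⁻¹' A i)) := by
    have h1 := h.measure_inter_preimage_eq_mul (u ×ˢ Finset.univ) (sets := E) fun p _ => hE p
    rw [Finset.prod_product] at h1
    simp only [Fintype.prod_bool, E, if_true, Bool.false_eq_true, if_false] at h1
    rw [← h1]
    congr 1
    ext ω
    simp only [Set.mem_iInter, Finset.mem_product, Finset.mem_univ, and_true, Prod.forall,
      Bool.forall_bool, Set.mem_preimage]
    refine forall_congr' fun i => ?_
    by_cases hi : i ∈ u
    · simp [hi, hAB i (hu hi)]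
    · simp [hi]
  rw [key s subset_rfl]
  refine Finset.prod_congr rfl fun i hi => ?_
  simpa using! (key {i} (by simpa using hi)).symm

/-- Non-overlapping pairs of an i.i.d. sequence with law `L`, inserted into a function that is
measurable up to `L ⊗ L`-null sets, form an i.i.d. sequence. -/
theorem iIndepFun_and_identDistrib_of_pairs {Ω' α : Type*} [MeasurableSpace Ω']
    [MeasurableSpace α] {P : Measure Ω'} [IsProbabilityMeasure P] {L : Measure α}
    {D : ℕ → Ω' → α} (hD : ∀ i, Measurable (D i)) (hind : iIndepFun D P)
    (hlaw : ∀ i, P.map (D i) = L) {h : α × α → ℝ}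
    (hh : AEMeasurable h (L.prod L)) :
    iIndepFun (fun i ω => h (D (2 * i) ω, D (2 * i + 1) ω)) P ∧
      ∀ i, IdentDistrib (fun ω => h (D (2 * i) ω, D (2 * i + 1) ω)) h P (L.prod L) := by
  let pair (i : ℕ) (ω : Ω') : α × α := (D (2 * i) ω, D (2 * i + 1) ω)
  have hpm (i : ℕ) : Measurable (pair i) := (hD _).prodMk (hD _)
  have hpair (i : ℕ) : P.map (pair i) = L.prod L := by
    have h1 := (indepFun_iff_map_prod_eq_prod_map_map (hD (2 * i)).aemeasurable
      (hD (2 * i + 1)).aemeasurable).1 (hind.indepFun (by omega))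
    rwa [hlaw, hlaw] at h1
  have hinj : Function.Injective fun p : ℕ × Bool => 2 * p.1 + p.2.toNat := by
    rintro ⟨i, _ | _⟩ ⟨j, _ | _⟩ hij <;> simp at hij ⊢ <;> omega
  have hpind : iIndepFun pair P :=
    iIndepFun_prodMk_of_pairs (X := fun p : ℕ × Bool => D (2 * p.1 + p.2.toNat))
      (fun p => hD _) (hind.precomp hinj)
  constructor
  · refine (hpind.comp (fun _ => hh.mk h) fun _ => hh.measurable_mk).congr fun i => ?_
    have hae : ∀ᵐ z ∂P.map (pair i), h z = hh.mk h z := by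
      rw [hpair i]
      exact hh.ae_eq_mk
    filter_upwards [ae_of_ae_map (hpm i).aemeasurable hae] with ω hω
    exact hω.symm
  · intro i
    have hp : IdentDistrib (pair i) id P (L.prod L) :=
      ⟨(hpm i).aemeasurable, aemeasurable_id, by rw [hpair i, Measure.map_id]⟩
    exact hp.comp_of_aemeasurable (by rwa [hpair i])

/-! ### Limit theorems for independent, identically distributed random variables -/

section Limits

variable {Ω : Type*} [MeasurableSpace Ω] {P : Measure Ω} [IsProbabilityMeasure P]
  {W : ℕ → Ω → ℝ}

/-- The central limit theorem, for a mean over a number `r n → ∞` of terms. -/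
theorem tendstoInDistribution_sqrt_mul_mean_sub (hW : MemLp (W 0) 2 P) (hind : iIndepFun W P)
    (hid : ∀ i, IdentDistrib (W i) (W 0) P P) {r : ℕ → ℕ} (hr : Tendsto r atTop atTop) :
    TendstoInDistribution
      (fun (n : ℕ) ω => √(r n : ℝ) * ((r n : ℝ)⁻¹ * ∑ i ∈ Finset.range (r n), W i ω - P[W 0]))
      atTop (id : ℝ → ℝ) (fun _ => P) (gaussianReal 0 Var[W 0; P].toNNReal) := by
  have h := tendstoInDistribution_inv_sqrt_mul_sum_sub (Y := (id : ℝ → ℝ)) HasLaw.id hW hind hid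
  have h' : TendstoInDistribution
      (fun (n : ℕ) ω => (√(r n : ℝ))⁻¹ * (∑ i ∈ Finset.range (r n), W i ω - (r n : ℝ) * P[W 0]))
      atTop (id : ℝ → ℝ) (fun _ => P) (gaussianReal 0 Var[W 0; P].toNNReal) :=
    { forall_aemeasurable := fun n => h.forall_aemeasurable (r n)
      aemeasurable_limit := h.aemeasurable_limit
      tendsto := h.tendsto.comp hr }
  refine h'.congr (fun n => Eventually.of_forall fun ω => ?_) .rfl
  -- for `r n = 0` both sides vanish, because of the factors `√0` and `(√0)⁻¹ = 0`
  rcases eq_or_ne (r n) 0 with h0 | h0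
  · simp [h0]
  have hpos : (0 : ℝ) < r n := by positivity
  have hs : √(r n : ℝ) ≠ 0 := (Real.sqrt_pos.2 hpos).ne'
  have hsq : √(r n : ℝ) * √(r n : ℝ) = r n := Real.mul_self_sqrt hpos.le
  simp only
  generalize ∑ i ∈ Finset.range (r n), W i ω = a
  generalize P[W 0] = b
  generalize √(r n : ℝ) = c at hs hsq
  rw [← hsq]
  field_simp

/-- The sample variance with divisor `n - 1` is strongly consistent. -/
theorem ae_tendsto_sampleVariance (hW : MemLp (W 0) 2 P) (hind : iIndepFun W P)
    (hid : ∀ i, IdentDistrib (W i) (W 0) P P) :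
    ∀ᵐ ω ∂P, Tendsto (fun n : ℕ => ((n : ℝ) - 1)⁻¹ *
      ∑ i ∈ Finset.range n, (W i ω - (n : ℝ)⁻¹ * ∑ j ∈ Finset.range n, W j ω) ^ 2)
      atTop (𝓝 Var[W 0; P]) := by
  have h1 := strong_law_ae_real W (hW.integrable one_le_two)
    (fun i j hij => hind.indepFun hij) hid
  have h2 := strong_law_ae_real (fun i ω => W i ω ^ 2) hW.integrable_sq
    (fun i j hij => (hind.indepFun hij).comp (measurable_id.pow_const 2)
      (measurable_id.pow_const 2)) fun i => (hid i).comp (measurable_id.pow_const 2)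
  filter_upwards [h1, h2] with ω h1 h2
  have h3 : Tendsto (fun n : ℕ => (n : ℝ) / ((n : ℝ) - 1)) atTop (𝓝 1) := by
    simpa [sub_eq_add_neg] using! tendsto_natCast_div_add_atTop (-1 : ℝ)
  have h4 := h3.mul (h2.sub (h1.pow 2))
  rw [one_mul] at h4
  rw [variance_eq_sub hW]
  refine h4.congr' ?_
  filter_upwards [eventually_gt_atTop 1] with n hn
  have hn1 : (1 : ℝ) < n := by exact_mod_cast hn
  have hn0 : (n : ℝ) ≠ 0 := by positivity
  have hn2 : (n : ℝ) - 1 ≠ 0 := by linarith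
  have hexp (c : ℝ) : ∑ i ∈ Finset.range n, (W i ω - c) ^ 2 =
      ∑ i ∈ Finset.range n, W i ω ^ 2 - 2 * c * ∑ i ∈ Finset.range n, W i ω + n * c ^ 2 := by
    simp only [sub_sq, Finset.sum_add_distrib, Finset.sum_sub_distrib, Finset.sum_const,
      Finset.card_range, nsmul_eq_mul, Finset.mul_sum]
    congr 2
    exact Finset.sum_congr rfl fun i _ => by ring
  rw [hexp]
  field_simp
  ring

theorem continuous_cdf (ν : Measure ℝ) [IsProbabilityMeasure ν] [NullSingletonClass ν] :
    Continuous (cdf ν) := by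
  refine continuous_iff_continuousAt.2 fun x => ?_
  rw [(monotone_cdf ν).continuousAt_iff_leftLim_eq_rightLim, (cdf ν).rightLim_eq]
  have h := (cdf ν).measure_singleton x
  rw [measure_cdf, measure_singleton, eq_comm, ENNReal.ofReal_eq_zero] at h
  exact le_antisymm ((monotone_cdf ν).leftLim_le le_rfl) (by linarith)

theorem gaussianReal_real_Ici {σ : ℝ} (hσ : 0 < σ) (t : ℝ) :
    (gaussianReal 0 (σ ^ 2).toNNReal).real (Set.Ici t) = 1 - cdf (gaussianReal 0 1) (t / σ) := by
  have hmap : gaussianReal 0 (σ ^ 2).toNNReal = (gaussianReal 0 1).map (σ * ·) := by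
    rw [gaussianReal_map_const_mul]
    congr 1
    · simp
    · ext; simp [sq_nonneg]
  have hpre : (σ * ·) ⁻¹' Set.Ici t = Set.Ici (t / σ) := by
    ext x
    simp [div_le_iff₀' hσ]
  have : NullSingletonClass (gaussianReal 0 1) := nullSingletonClass_gaussianReal one_ne_zero
  rw [hmap, map_measureReal_apply (by fun_prop) measurableSet_Ici, hpre,
    measureReal_congr Ioi_ae_eq_Ici.symm, cdf_eq_real, ← Set.compl_Iic,
    probReal_compl_eq_one_sub measurableSet_Iic]

/-- Convergence in distribution to a centred normal law gives convergence of the upper tail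
probabilities, since the limit has no atoms. -/
theorem tendsto_measureReal_le_of_tendstoInDistribution {V : ℕ → Ω → ℝ} {σ : ℝ} (hσ : 0 < σ)
    (h : TendstoInDistribution V atTop (id : ℝ → ℝ) (fun _ => P)
      (gaussianReal 0 (σ ^ 2).toNNReal)) (t : ℝ) :
    Tendsto (fun n => P.real {ω | t ≤ V n ω}) atTop (𝓝 (1 - cdf (gaussianReal 0 1) (t / σ))) := by
  have hv : (σ ^ 2).toNNReal ≠ 0 := (Real.toNNReal_pos.2 (by positivity)).ne'
  have : NullSingletonClass (gaussianReal 0 (σ ^ 2).toNNReal) := nullSingletonClass_gaussianReal hv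
  have key := ProbabilityMeasure.tendsto_measure_of_null_frontier_of_tendsto' h.tendsto
    (E := Set.Ici t) (by simp)
  simp only [ProbabilityMeasure.coe_mk, Measure.map_id] at key
  rw [← gaussianReal_real_Ici hσ t]
  refine ((ENNReal.tendsto_toReal (measure_ne_top _ _)).comp key).congr fun n => ?_
  simp only [Function.comp]
  rw [Measure.map_apply_of_aemeasurable (h.forall_aemeasurable n) measurableSet_Ici]
  rfl

end Limits

end CalibrationError

theorem mainTheorem6 {Ω Ω' S : Type*} [MeasurableSpace Ω] [MeasurableSpace Ω'] [MeasurableSpace S]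
    {m : ℕ} [NeZero m]
    (μ : Measure Ω) [IsProbabilityMeasure μ] (P : Measure Ω') [IsProbabilityMeasure P]
    -- the pair `(X, Y)`, its law `L`, and the model `g`
    (X : Ω → S) (hX : Measurable X) (Y : Ω → Fin m) (hY : Measurable Y)
    (L : Measure (S × Fin m)) (hL : L = μ.map (fun ω => (X ω, Y ω)))
    (g : S → CalibrationError.Simplex m) (hg : Measurable g)
    -- the kernel
    (k : CalibrationError.Simplex m → CalibrationError.Simplex m →
      (CalibrationError.Vec m →L[ℝ] CalibrationError.Vec m))
    (hk : CalibrationError.IsMatrixKernel k)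
    (hkm : ∀ (t : CalibrationError.Simplex m) (u : CalibrationError.Vec m),
      Measurable (fun s => k s t u))
    (hk1 : CalibrationError.kernelNorm k 1 (μ.map (fun ω => g (X ω))) < ⊤)
    -- the data, i.i.d. as `(X, Y)`
    (D : ℕ → Ω' → S × Fin m) (hDm : ∀ i, Measurable (D i)) (hDind : iIndepFun D P)
    (hDid : ∀ i, IdentDistrib (D i) (fun ω => (X ω, Y ω)) P μ)
    -- `h((X,Y),(X',Y'))` is a random variable of finite variance `σ²` under the law `L ⊗ L`
    (hhm : AEMeasurable (fun z : (S × Fin m) × (S × Fin m) =>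
      CalibrationError.hker k g z.1 z.2) (L.prod L))
    (hvar : evariance (fun z : (S × Fin m) × (S × Fin m) =>
      CalibrationError.hker k g z.1 z.2) (L.prod L) < ⊤)
    (σ : ℝ) (hσ0 : 0 ≤ σ)
    (hσ : σ ^ 2 = variance (fun z : (S × Fin m) × (S × Fin m) =>
      CalibrationError.hker k g z.1 z.2) (L.prod L)) :
    -- the functions over which the calibration error is a supremum are integrable
    (∀ f ∈ CalibrationError.rkhsUnitBall k hk, Integrable f (μ.map (fun ω => g (X ω)))) ∧
    -- the squared kernel calibration error is finite, and the asymptotic normality holds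
    (∃ s : ℝ, CalibrationError.skce k hk μ Y (fun ω => g (X ω)) = (s : EReal) ∧
      TendstoInDistribution
        (fun (n : ℕ) (ω : Ω') => √((n / 2 : ℕ) : ℝ) *
          (CalibrationError.skceUL k g n (fun i => D i ω) - s))
        atTop (id : ℝ → ℝ) (fun _ => P) (gaussianReal 0 (σ ^ 2).toNNReal)) ∧
    -- the approximation of the p-value under the null hypothesis
    (CalibrationError.StronglyCalibrated μ Y (fun ω => g (X ω)) → 0 < σ → ∀ t : ℝ,
      Tendsto (fun n : ℕ => P.real {ω | t ≤ √((n / 2 : ℕ) : ℝ) *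
          CalibrationError.skceUL k g n (fun i => D i ω)})
        atTop (𝓝 (1 - cdf (gaussianReal 0 1) (t / σ))) ∧
      ∀ᵐ ω' ∂P, Tendsto (fun n : ℕ => P.real {ω | t ≤ √((n / 2 : ℕ) : ℝ) *
          CalibrationError.skceUL k g n (fun i => D i ω)} -
          (1 - cdf (gaussianReal 0 1) (t / CalibrationError.sampleSD k g n (fun i => D i ω'))))
        atTop (𝓝 0)) := by
  have hprob : IsProbabilityMeasure L :=
    hL ▸ Measure.isProbabilityMeasure_map (hX.prodMk hY).aemeasurable
  let h (z : (S × Fin m) × (S × Fin m)) : ℝ := CalibrationError.hker k g z.1 z.2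
  have hh2 : MemLp h 2 (L.prod L) :=
    (evariance_lt_top_iff_memLp hhm.aestronglyMeasurable).1 hvar
  obtain ⟨s, hs, hmean, hs0⟩ := CalibrationError.exists_skce_eq_integral_hker hX hY hg hk hkm hk1 hL
    (hh2.integrable one_le_two)
  let W (i : ℕ) (ω : Ω') : ℝ := h (D (2 * i) ω, D (2 * i + 1) ω)
  obtain ⟨hWind, hWh⟩ := CalibrationError.iIndepFun_and_identDistrib_of_pairs (h := h) hDm hDind
    (fun i => (hDid i).map_eq.trans hL.symm) hhm
  have hWid (i : ℕ) : IdentDistrib (W i) (W 0) P P := (hWh i).trans (hWh 0).symm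
  have hW2 : MemLp (W 0) 2 P := (hWh 0).memLp_iff.2 hh2
  have hWmean : P[W 0] = s := (hWh 0).integral_eq.trans hmean
  have hWvar : Var[W 0; P] = σ ^ 2 := (hWh 0).variance_eq.trans hσ.symm
  have hr : Tendsto (fun n : ℕ => n / 2) atTop atTop := Nat.tendsto_div_const_atTop two_ne_zero
  have hclt := CalibrationError.tendstoInDistribution_sqrt_mul_mean_sub hW2 hWind hWid hr
  rw [hWmean, hWvar] at hclt
  refine ⟨CalibrationError.forall_mem_rkhsUnitBall_integrable hk hkm hk1, ⟨s, hs, hclt⟩, ?_⟩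
  intro hcal hσpos t
  rw [hs0 hcal] at hclt
  simp only [sub_zero] at hclt
  have htail := CalibrationError.tendsto_measureReal_le_of_tendstoInDistribution hσpos hclt t
  refine ⟨htail, ?_⟩
  filter_upwards [CalibrationError.ae_tendsto_sampleVariance hW2 hWind hWid] with ω' hω'
  have hsd : Tendsto (fun n => CalibrationError.sampleSD k g n fun i => D i ω') atTop (𝓝 σ) := by
    have h1 := (hω'.comp hr).sqrt
    rwa [hWvar, Real.sqrt_sq hσ0] at h1
  have : NullSingletonClass (gaussianReal 0 1) := nullSingletonClass_gaussianReal one_ne_zero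
  have hcdf := ((CalibrationError.continuous_cdf (gaussianReal 0 1)).tendsto (t / σ)).comp
    (tendsto_const_nhds.div hsd hσpos.ne')
  have hdiff := htail.sub ((tendsto_const_nhds (x := (1 : ℝ))).sub hcdf)
  rwa [sub_self] at hdiff
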